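/- **Theorem (query lower bound for low-energy simulation).** Call a Hermitian matrix $H$ 2-sparse (up to a constant energy shift) if $H=H'+aI$ with $a\in\mathbb R$ and every row of $H'$ has at most two nonzero entries. A quantum algorithm with query access to $H$ acts on the system, a row register and a work register; it alternates $H$-independent unitaries with queries $I\otimes\sum_r|r\rangle\langle r|\otimes W_r(H_{r,\cdot})$, where the unitary $W_r(H_{r,\cdot})$ on the work register may depend arbitrarily on the $r$-th row of $H$ (this includes the usual position and value oracles for sparse Hamiltonians), and finally discards all registers but the system; let $\mathcal U_H$ be the channel on the system that it implements. It simulates $H$ on the state $\rho$ for time $t$ to accuracy $\epsilon$ if $\|\mathcal U_H(\rho)-e^{-iHt}\rho\, e^{iHt}\|\le\epsilon$ in spectral norm. The scaled time is $\tau=\|H\|\,|t|$. For every real $D>0$ one can construct finite-dimensional 2-sparse positive semidefinite Hamiltonians $H$ with $\|H\|=D$ and minimum eigenvalue $0$, arranged for each dimension $n$ in a (possibly empty) family $\mathcal H_{D,n}$ of $n\times n$ matrices, such that the following holds. For every $\gamma\in(0,1)$ there are constants $c>0$ and $R_0$, depending only on $\gamma$, such that for all $D>0$, $0<\Delta\le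 D$, $\epsilon>0$ with $\Delta/\epsilon\ge R_0$ and $D\le(\Delta/\epsilon)^{\gamma}$, and all $\tau\ge1$, there are a dimension $n$ with $\mathcal H_{D,n}\neq\emptyset$ and a density matrix $\rho$ with energy $\operatorname{Tr}(H\rho)\le\Delta$ for every $H\in\mathcal H_{D,n}$, such that, for each $t\in\{\tau/D,-\tau/D\}$, every quantum query algorithm that simulates every $H\in\mathcal H_{D,n}$ on $\rho$ for time $t$ to accuracy $\epsilon$ makes at least $$c\cdot\max\left\{\tau,\ \frac{\log(\Delta/\epsilon)}{\log\log(\Delta/\epsilon)}\right\}$$ queries to $H$. -/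

import Mathlib

open scoped Matrix ComplexOrder Matrix.Norms.L2Operator

namespace LowEnergySimulation

noncomputable section

/-- `H` is `2`-sparse up to a constant energy shift: `H = H' + a I`, where every row of `H'` has at
most two nonzero entries. (The shift only contributes a global phase to the dynamics.) -/
def IsTwoSparse {n : ℕ} (H : Matrix (Fin n) (Fin n) ℂ) : Prop :=
  ∃ a : ℝ, ∀ i : Fin n, {j : Fin n | (H - (a : ℂ) • (1 : Matrix (Fin n) (Fin n) ℂ)) i j ≠ 0}.ncard ≤ 2

/-- Density matrices. -/
def IsState {n : ℕ} (ρ : Matrix (Fin n) (Fin n) ℂ) : Prop :=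
  ρ.PosSemidef ∧ ρ.trace = 1

/-- The energy `Tr (H ρ)`. -/
def energy {n : ℕ} (H ρ : Matrix (Fin n) (Fin n) ℂ) : ℝ :=
  (H * ρ).trace.re

/-- The propagator `V = exp (-i H t)`. -/
def propagator {n : ℕ} (H : Matrix (Fin n) (Fin n) ℂ) (t : ℝ) : Matrix (Fin n) (Fin n) ℂ :=
  NormedSpace.exp ((-(Complex.I * (t : ℂ))) • H)

/-- The exact evolution `V ρ V†` of the state `ρ` for time `t`. -/
def evolved {n : ℕ} (H : Matrix (Fin n) (Fin n) ℂ) (t : ℝ) (ρ : Matrix (Fin n) (Fin n) ℂ) :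
    Matrix (Fin n) (Fin n) ℂ :=
  propagator H t * ρ * (propagator H t)ᴴ

/-- The partial trace over the second tensor factor. -/
def traceOutRight {ι κ : Type*} [Fintype κ] (M : Matrix (ι × κ) (ι × κ) ℂ) : Matrix ι ι ℂ :=
  fun i j => ∑ a : κ, M (i, a) (j, a)

/-- A quantum query algorithm with oracle access to an `n × n` Hamiltonian, on three registers:
the system (basis `Fin n`), the row register (basis `Fin n`) and a work register of an arbitrary
finite dimension (basis `Fin work`). It applies
`gate 0`, query, `gate 1`, query, …, query, `gate queries`,
where the gates are arbitrary unitaries on all registers that do not depend on the Hamiltonian.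
A query, for row-register content `r`, applies to the work register the unitary `answer r (H r)`,
which may depend in any way on the whole `r`-th row of `H`. This is at least as powerful as the
usual oracles for sparse Hamiltonians, `|r, l, z⟩ ↦ |r, l, z ⊕ (position and value of the l-th
nonzero entry of row r)⟩`, `|r, l⟩ ↦ |r, f(r, l)⟩`, `|r, k, z⟩ ↦ |r, k, z ⊕ H r k⟩`, with any
encoding of the values, and as their inverses and controlled versions. -/
structure QueryAlgorithm (n : ℕ) where
  /-- the number of queries -/
  queries : ℕ
  /-- the dimension of the work register -/
  work : ℕ
  /-- the initial basis state of the row register and the work register -/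
  init : Fin n × Fin work
  /-- the gates between the queries (only `gate 0, …, gate queries` are used) -/
  gate : ℕ → Matrix.unitaryGroup (Fin n × (Fin n × Fin work)) ℂ
  /-- the response to a query, as a function of the row index and of that row of `H` -/
  answer : Fin n → (Fin n → ℂ) → Matrix.unitaryGroup (Fin work) ℂ

namespace QueryAlgorithm

variable {n : ℕ}

/-- One query: `I ⊗ ∑ r, |r⟩⟨r| ⊗ answer r (H r)`. -/
def query (A : QueryAlgorithm n) (H : Matrix (Fin n) (Fin n) ℂ) :
    Matrix (Fin n × (Fin n × Fin A.work)) (Fin n × (Fin n × Fin A.work)) ℂ :=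
  fun p p' => if p.1 = p'.1 ∧ p.2.1 = p'.2.1 then
    (A.answer p.2.1 (H p.2.1) : Matrix (Fin A.work) (Fin A.work) ℂ) p.2.2 p'.2.2 else 0

/-- The operator applied by the algorithm up to and including `gate k`. -/
def circuit (A : QueryAlgorithm n) (H : Matrix (Fin n) (Fin n) ℂ) :
    ℕ → Matrix (Fin n × (Fin n × Fin A.work)) (Fin n × (Fin n × Fin A.work)) ℂ
  | 0 => (A.gate 0 : Matrix _ _ ℂ)
  | k + 1 => (A.gate (k + 1) : Matrix _ _ ℂ) * A.query H * A.circuit H k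

/-- The channel on the system implemented by the algorithm: adjoin the initial state of the other
registers, run the circuit with all its queries, trace out the other registers. -/
def channel (A : QueryAlgorithm n) (H ρ : Matrix (Fin n) (Fin n) ℂ) : Matrix (Fin n) (Fin n) ℂ :=
  traceOutRight (A.circuit H A.queries *
    Matrix.kronecker ρ (Matrix.single A.init A.init (1 : ℂ)) * (A.circuit H A.queries)ᴴ)

/-- The algorithm simulates, on the input state `ρ`, the evolution under `H` for time `t` with
spectral-norm error at most `ε`. -/
def Simulates (A : QueryAlgorithm n) (H ρ : Matrix (Fin n) (Fin n) ℂ) (t ε : ℝ) : Prop :=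
  ‖A.channel H ρ - evolved H t ρ‖ ≤ ε

end QueryAlgorithm

end

end LowEnergySimulation

namespace LowEnergySimulation

noncomputable section

/-! ### Functions of few bits -/

section Junta

variable {κ : Type*}

/-! Computing the parity of N hidden bits needs a number of queries linear in N, and short-time
evolution of a low-energy state can already reveal that parity. The bits twist two copies of a path:
the label changes by one bit at each step, so a particle reaching the far end carries the total
parity as its label. With the couplings of a spin N/2 in a transverse field the motion is explicit,
and a particle started at the near end is at the far end with probability sin(Dt/2N)^(2N). The path
is mixed with a decoupled ground state: weight p = Δ/D on its first vertex keeps the energy at Δ/2,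
and the signal left at the end is p sin(Dt/2N)^(2N) (`evolved_inputState_apply`).

If 2ε is below this signal, a simulation must also give the two end sites populations whose
difference has the sign of the parity. Each row involves at most two bits, so after q queries these
populations are combinations of functions of at most 4q bits (`channel_apply_mem_juntaSpan`).
Functions of fewer than N bits are orthogonal to the parity, hence N ≤ 4q (`card_le_of_parity`,
`le_queries`).

It remains to take N as large as the signal permits: of order τ, or of order L / log L with L =
log(Δ/ε), whichever is larger (`exists_path_length`). The condition D ≤ (Δ/ε)^γ makes ε/p at most
exp(-(1-γ)L). -/

/-- The span of the functions on `κ → ZMod 2` that depend on at most `d` bits. -/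
def juntaSpan (κ : Type*) (d : ℕ) : Submodule ℂ ((κ → ZMod 2) → ℂ) :=
  Submodule.span ℂ {f | ∃ S : Finset κ, S.card ≤ d ∧ DependsOn f (S : Set κ)}

lemma mem_juntaSpan_of_dependsOn {d : ℕ} {f : (κ → ZMod 2) → ℂ} (S : Finset κ) (hS : S.card ≤ d)
    (hf : DependsOn f (S : Set κ)) : f ∈ juntaSpan κ d :=
  Submodule.subset_span ⟨S, hS, hf⟩

lemma const_mem_juntaSpan (d : ℕ) (c : ℂ) : (fun _ => c) ∈ juntaSpan κ d :=
  mem_juntaSpan_of_dependsOn ∅ (by simp) fun _ _ _ => rfl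

lemma mul_mem_juntaSpan {a b : ℕ} {f g : (κ → ZMod 2) → ℂ} (hf : f ∈ juntaSpan κ a)
    (hg : g ∈ juntaSpan κ b) : f * g ∈ juntaSpan κ (a + b) := by
  classical
  have h := Submodule.mul_mem_mul hf hg
  rw [juntaSpan, juntaSpan, Submodule.span_mul_span] at h
  refine Submodule.span_mono ?_ h
  rintro _ ⟨u, ⟨S, hS, hu⟩, v, ⟨T, hT, hv⟩, rfl⟩
  refine ⟨S ∪ T, (Finset.card_union_le S T).trans (add_le_add hS hT), fun x y hxy => ?_⟩
  have h1 : u x = u y := hu fun i hi => hxy i (by simp_all)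
  have h2 : v x = v y := hv fun i hi => hxy i (by simp_all)
  simp [h1, h2]

lemma star_mem_juntaSpan {d : ℕ} {f : (κ → ZMod 2) → ℂ} (hf : f ∈ juntaSpan κ d) :
    star f ∈ juntaSpan κ d := by
  induction hf using Submodule.span_induction with
  | mem u hu =>
    obtain ⟨S, hS, hu⟩ := hu
    exact mem_juntaSpan_of_dependsOn S hS fun x y hxy => by simp [hu hxy]
  | zero => simp
  | add u v _ _ hu hv => rw [star_add]; exact add_mem hu hv
  | smul c u _ hu => rw [star_smul]; exact Submodule.smul_mem _ _ hu

/-- The character `z ↦ (-1) ^ z` of `ZMod 2`. -/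
def sign (z : ZMod 2) : ℂ := if z = 0 then 1 else -1

lemma sign_add_one (z : ZMod 2) : sign (z + 1) = -sign z := by
  have h : z + 1 = 0 ↔ z ≠ 0 := by revert z; decide
  by_cases hz : z = 0 <;> simp [sign, h, hz]

/-- Flipping a bit outside `S` preserves `u` and negates the parity sign, so the sum equals its own
negative. -/
lemma sum_sign_mul_eq_zero [Fintype κ] [DecidableEq κ] {d : ℕ} (hd : d < Fintype.card κ)
    {f : (κ → ZMod 2) → ℂ} (hf : f ∈ juntaSpan κ d) :
    ∑ x, sign (∑ k, x k) * f x = 0 := by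
  induction hf using Submodule.span_induction with
  | mem u hu =>
    obtain ⟨S, hS, hu⟩ := hu
    obtain ⟨k, hk⟩ : ∃ k, k ∉ S := by
      by_contra! h
      have := Finset.card_le_card (fun k _ => h k : Finset.univ ⊆ S)
      rw [Finset.card_univ] at this
      omega
    have h := Equiv.sum_comp (Equiv.addRight (Pi.single k (1 : ZMod 2)))
      fun x : κ → ZMod 2 => sign (∑ k, x k) * u x
    have h2 : ∀ x : κ → ZMod 2, u (x + Pi.single k 1) = u x := fun x => hu fun i hi => by
      have : i ≠ k := fun h => hk (by simpa [h] using hi)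
      simp [this]
    simp only [Equiv.coe_addRight, Pi.add_apply, Finset.sum_add_distrib, Finset.sum_pi_single',
      Finset.mem_univ, if_true, sign_add_one, h2, neg_mul, Finset.sum_neg_distrib] at h
    exact self_eq_neg.mp h.symm
  | zero => simp
  | add u v _ _ hu hv => simp [mul_add, Finset.sum_add_distrib, hu, hv]
  | smul c u _ hu =>
    simp only [Pi.smul_apply, smul_eq_mul, mul_left_comm _ c, ← Finset.mul_sum, hu, mul_zero]

end Junta

/-! ### The polynomial method for query algorithms -/

namespace QueryAlgorithm

variable {n : ℕ} {κ : Type*} (A : QueryAlgorithm n)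
  {H : (κ → ZMod 2) → Matrix (Fin n) (Fin n) ℂ}

lemma query_apply_mem_juntaSpan {d : ℕ} {S : Fin n → Finset κ} (hS : ∀ r, (S r).card ≤ d)
    (hH : ∀ r, DependsOn (fun x => H x r) (S r : Set κ)) (p q) :
    (fun x => A.query (H x) p q) ∈ juntaSpan κ d :=
  mem_juntaSpan_of_dependsOn (S p.2.1) (hS _) fun x y hxy => by
    have h : H x p.2.1 = H y p.2.1 := hH p.2.1 hxy
    simp only [query, h]

lemma circuit_apply_mem_juntaSpan {d : ℕ} {S : Fin n → Finset κ} (hS : ∀ r, (S r).card ≤ d)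
    (hH : ∀ r, DependsOn (fun x => H x r) (S r : Set κ)) (k : ℕ) (p q) :
    (fun x => A.circuit (H x) k p q) ∈ juntaSpan κ (d * k) := by
  induction k generalizing p q with
  | zero => exact const_mem_juntaSpan _ _
  | succ k ih =>
    have h : (fun x => A.circuit (H x) (k + 1) p q) = ∑ r, ∑ s,
        (A.gate (k + 1) : Matrix _ _ ℂ) p s •
          ((fun x => A.query (H x) s r) * fun x => A.circuit (H x) k r q) := by
      funext x
      simp [circuit, Matrix.mul_apply, Finset.sum_apply, Finset.sum_mul, mul_assoc]
    rw [h, mul_add, mul_one, add_comm]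
    exact sum_mem fun r _ => sum_mem fun s _ => Submodule.smul_mem _ _
      (mul_mem_juntaSpan (A.query_apply_mem_juntaSpan hS hH _ _) (ih _ _))

/-- The output is bilinear in the circuit and its conjugate, which doubles the degree `d *
A.queries`. -/
lemma channel_apply_mem_juntaSpan {d : ℕ} {S : Fin n → Finset κ} (hS : ∀ r, (S r).card ≤ d)
    (hH : ∀ r, DependsOn (fun x => H x r) (S r : Set κ)) (ρ : Matrix (Fin n) (Fin n) ℂ) (i j) :
    (fun x => A.channel (H x) ρ i j) ∈ juntaSpan κ (d * A.queries + d * A.queries) := by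
  set K := Matrix.kronecker ρ (Matrix.single A.init A.init (1 : ℂ)) with hK
  have h : (fun x => A.channel (H x) ρ i j) = ∑ a, ∑ q, ∑ p, K p q •
      ((fun x => A.circuit (H x) A.queries (i, a) p) *
        star fun x => A.circuit (H x) A.queries (j, a) q) := by
    funext x
    simp only [channel, traceOutRight, ← hK, Matrix.mul_apply, Finset.sum_apply, Pi.smul_apply,
      Pi.mul_apply, Pi.star_apply, Matrix.conjTranspose_apply, Finset.sum_mul, smul_eq_mul]
    refine Finset.sum_congr rfl fun a _ => Finset.sum_congr rfl fun q _ =>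
      Finset.sum_congr rfl fun p _ => by ring
  rw [h]
  exact sum_mem fun a _ => sum_mem fun q _ => sum_mem fun p _ => Submodule.smul_mem _ _
    (mul_mem_juntaSpan (A.circuit_apply_mem_juntaSpan hS hH _ _ _)
      (star_mem_juntaSpan (A.circuit_apply_mem_juntaSpan hS hH _ _ _)))

/-- If, for all hidden bits, the difference of two outcome probabilities has the sign of the
parity, then the algorithm has made enough queries to see all bits. -/
lemma card_le_of_parity [Fintype κ] [DecidableEq κ] {d : ℕ} {S : Fin n → Finset κ} (hS : ∀ r, (S r).card ≤ d)
    (hH : ∀ r, DependsOn (fun x => H x r) (S r : Set κ)) (ρ : Matrix (Fin n) (Fin n) ℂ)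
    (i j : Fin n) (hpos : ∀ x, 0 < (sign (∑ k, x k) *
      (A.channel (H x) ρ i i - A.channel (H x) ρ j j)).re) :
    Fintype.card κ ≤ 2 * d * A.queries := by
  by_contra! hlt
  have h := sum_sign_mul_eq_zero (d := d * A.queries + d * A.queries) (by linarith)
    (sub_mem (A.channel_apply_mem_juntaSpan hS hH ρ i i)
      (A.channel_apply_mem_juntaSpan hS hH ρ j j))
  have h2 := congrArg Complex.re h
  rw [Complex.re_sum, Complex.zero_re] at h2
  exact (Finset.sum_pos (fun x _ => hpos x) Finset.univ_nonempty).ne' h2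

end QueryAlgorithm

/-! ### Linear algebra -/

section Matrices

variable {ι : Type*} [Fintype ι] [DecidableEq ι]

lemma norm_apply_le_l2_opNorm (M : Matrix ι ι ℂ) (i j : ι) : ‖M i j‖ ≤ ‖M‖ := by
  have h := Matrix.l2_opNorm_mulVec M (EuclideanSpace.single j (1 : ℂ))
  have h2 := PiLp.norm_apply_le (WithLp.toLp 2 (M *ᵥ (EuclideanSpace.single j (1 : ℂ)).ofLp)) i
  simp at h h2
  exact h2.trans h

/-- Uniqueness for linear ODEs: an explicit solution replaces diagonalising the Hamiltonian. -/
lemma exp_smul_mulVec_of_hasDerivAt (A : Matrix ι ι ℂ) (ψ : ℝ → ι → ℂ)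
    (hψ : ∀ t, HasDerivAt ψ (A *ᵥ ψ t) t) (t : ℝ) :
    NormedSpace.exp (t • A) *ᵥ ψ 0 = ψ t := by
  let T : (ι → ℂ) →L[ℝ] (ι → ℂ) :=
    LinearMap.toContinuousLinearMap ((Matrix.mulVecLin A).restrictScalars ℝ)
  let E : Matrix ι ι ℂ →L[ℝ] (ι → ℂ) := LinearMap.toContinuousLinearMap
    { toFun := fun M => M *ᵥ ψ 0
      map_add' := fun M M' => Matrix.add_mulVec M M' _
      map_smul' := fun c M => by simp [Matrix.smul_mulVec] }
  have hE : ∀ s : ℝ, HasDerivAt (fun s : ℝ => E (NormedSpace.exp (s • A)))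
      (T (E (NormedSpace.exp (s • A)))) s := fun s => by
    have h := E.hasFDerivAt.comp_hasDerivAt s (hasDerivAt_exp_smul_const' (𝕂 := ℝ) A s)
    have h2 : E (A * NormedSpace.exp (s • A)) = T (E (NormedSpace.exp (s • A))) := by
      simp [E, T]
    rwa [h2] at h
  have h := ODE_solution_unique_univ (v := fun _ => T) (s := fun _ => Set.univ) (K := ‖T‖₊) (t₀ := 0)
    (f := fun s : ℝ => E (NormedSpace.exp (s • A))) (g := ψ)
    (fun _ => T.lipschitz.lipschitzOnWith) (fun s => ⟨hE s, trivial⟩) (fun s => ⟨hψ s, trivial⟩)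
    (by simp [E])
  exact congrFun h t

lemma propagator_mulVec_of_hasDerivAt {n : ℕ} (H : Matrix (Fin n) (Fin n) ℂ) (ψ : ℝ → Fin n → ℂ)
    (hψ : ∀ t, HasDerivAt ψ (-Complex.I • H *ᵥ ψ t) t) (t : ℝ) :
    propagator H t *ᵥ ψ 0 = ψ t := by
  rw [← exp_smul_mulVec_of_hasDerivAt (-Complex.I • H) ψ
    (fun t => by rw [Matrix.smul_mulVec]; exact hψ t) t, propagator]
  congr 2
  ext i j
  simp
  ring

/-- Schur's test, as a lower bound on a Hermitian matrix. -/
lemma posSemidef_smul_one_add {X : Matrix ι ι ℂ} (hX : X.IsHermitian) {v : ι → ℝ}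
    (hv : ∀ a, 0 < v a) {l : ℝ} (h : ∀ a, ∑ b, ‖X a b‖ * v b ≤ l * v a) :
    ((l : ℂ) • (1 : Matrix ι ι ℂ) + X).PosSemidef := by
  have hH : ((l : ℂ) • (1 : Matrix ι ι ℂ) + X).IsHermitian := by
    refine Matrix.IsHermitian.add ?_ hX
    simp [Matrix.IsHermitian, Matrix.conjTranspose_smul]
  refine Matrix.PosSemidef.of_dotProduct_mulVec_nonneg hH fun u => ?_
  have him := hH.im_star_dotProduct_mulVec_self u
  rw [RCLike.nonneg_iff]
  refine ⟨?_, him⟩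
  have hsymm : ∀ a b, ‖X a b‖ = ‖X b a‖ := fun a b => by rw [← hX.apply a b, norm_star]
  have key : ∑ a, ∑ b, ‖X a b‖ * (‖u a‖ * ‖u b‖) ≤ l * ∑ a, ‖u a‖ ^ 2 := by
    -- Weighted AM-GM, with weights chosen so that summation produces the row sums against `v`.
    have h1 : ∀ a b, ‖X a b‖ * (‖u a‖ * ‖u b‖) ≤
        (‖X a b‖ * v b * (‖u a‖ ^ 2 / v a)) / 2 + (‖X b a‖ * v a * (‖u b‖ ^ 2 / v b)) / 2 := by
      intro a b
      rw [hsymm b a]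
      have ha := hv a
      have hb := hv b
      have h2 : (‖X a b‖ * v b * (‖u a‖ ^ 2 / v a)) / 2 + (‖X a b‖ * v a * (‖u b‖ ^ 2 / v b)) / 2
          - ‖X a b‖ * (‖u a‖ * ‖u b‖) =
          ‖X a b‖ * (‖u a‖ * v b - ‖u b‖ * v a) ^ 2 / (2 * v a * v b) := by
        field_simp
        ring
      have h3 : 0 ≤ ‖X a b‖ * (‖u a‖ * v b - ‖u b‖ * v a) ^ 2 / (2 * v a * v b) := by positivity
      linarith
    calc ∑ a, ∑ b, ‖X a b‖ * (‖u a‖ * ‖u b‖)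
        ≤ ∑ a, ∑ b, ((‖X a b‖ * v b * (‖u a‖ ^ 2 / v a)) / 2 +
            (‖X b a‖ * v a * (‖u b‖ ^ 2 / v b)) / 2) :=
          Finset.sum_le_sum fun a _ => Finset.sum_le_sum fun b _ => h1 a b
      _ = ∑ a, ∑ b, ‖X a b‖ * v b * (‖u a‖ ^ 2 / v a) := by
          simp only [Finset.sum_add_distrib]
          rw [Finset.sum_comm (f := fun a b => (‖X b a‖ * v a * (‖u b‖ ^ 2 / v b)) / 2)]
          simp only [← Finset.sum_add_distrib, add_halves]
      _ = ∑ a, (∑ b, ‖X a b‖ * v b) * (‖u a‖ ^ 2 / v a) := by simp only [Finset.sum_mul]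
      _ ≤ ∑ a, l * v a * (‖u a‖ ^ 2 / v a) := Finset.sum_le_sum fun a _ =>
          mul_le_mul_of_nonneg_right (h a) (div_nonneg (sq_nonneg _) (hv a).le)
      _ = l * ∑ a, ‖u a‖ ^ 2 := by
          rw [Finset.mul_sum]
          refine Finset.sum_congr rfl fun a _ => ?_
          have := (hv a).ne'
          field_simp
  have h2 : star u ⬝ᵥ (X *ᵥ u) = ∑ a, ∑ b, star (u a) * (X a b * u b) := by
    simp [dotProduct, Matrix.mulVec, Finset.mul_sum]
  have h3 : star u ⬝ᵥ u = ((∑ a, ‖u a‖ ^ 2 : ℝ) : ℂ) := by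
    simp [dotProduct, Complex.conj_mul']
  have h4 : ‖star u ⬝ᵥ (X *ᵥ u)‖ ≤ ∑ a, ∑ b, ‖X a b‖ * (‖u a‖ * ‖u b‖) := by
    rw [h2]
    refine (norm_sum_le _ _).trans (Finset.sum_le_sum fun a _ =>
      (norm_sum_le _ _).trans (Finset.sum_le_sum fun b _ => ?_))
    rw [norm_mul, norm_mul, norm_star]
    exact le_of_eq (by ring)
  have h5 := (abs_le.mp (Complex.abs_re_le_norm (star u ⬝ᵥ (X *ᵥ u)))).1
  rw [Matrix.add_mulVec, Matrix.smul_mulVec, Matrix.one_mulVec, dotProduct_add,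
    dotProduct_smul, h3]
  simp only [smul_eq_mul, ← Complex.ofReal_mul]
  change 0 ≤ (_ + _ : ℂ).re
  rw [Complex.add_re, Complex.ofReal_re]
  linarith

open scoped MatrixOrder in
lemma l2_opNorm_le_of_posSemidef {H : Matrix ι ι ℂ} (hH : H.PosSemidef) {D : ℝ} (hD : 0 ≤ D)
    (h : ((D : ℂ) • (1 : Matrix ι ι ℂ) - H).PosSemidef) : ‖H‖ ≤ D := by
  rw [CStarAlgebra.norm_le_iff_le_algebraMap H hD (Matrix.nonneg_iff_posSemidef.mpr hH),
    Matrix.le_iff]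
  have h1 : algebraMap ℝ (Matrix ι ι ℂ) D = (D : ℂ) • 1 := by
    ext i j
    simp [Matrix.algebraMap_matrix_apply, Matrix.one_apply]
  rw [h1]
  exact h

lemma le_l2_opNorm_of_mulVec_eq {H : Matrix ι ι ℂ} {D : ℝ} {v : ι → ℂ} (hv : v ≠ 0)
    (h : H *ᵥ v = (D : ℂ) • v) : D ≤ ‖H‖ := by
  have h1 := Matrix.l2_opNorm_mulVec H (WithLp.toLp 2 v)
  have h2 : 0 < ‖WithLp.toLp 2 v‖ := norm_pos_iff.mpr (by simpa using hv)
  have h3 : ‖WithLp.toLp 2 (H *ᵥ v)‖ = |D| * ‖WithLp.toLp 2 v‖ := by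
    rw [h, WithLp.toLp_smul, norm_smul, Complex.norm_real, Real.norm_eq_abs]
  change ‖WithLp.toLp 2 (H *ᵥ v)‖ ≤ _ at h1
  rw [h3] at h1
  exact (le_abs_self D).trans (le_of_mul_le_mul_right h1 h2)

open scoped MatrixOrder in
lemma isLeast_spectrum_zero {H : Matrix ι ι ℂ} (hH : H.PosSemidef) {v : ι → ℂ} (hv : v ≠ 0)
    (h : H *ᵥ v = 0) : IsLeast (spectrum ℝ H) 0 := by
  refine ⟨?_, fun r hr => spectrum_nonneg_of_nonneg (Matrix.nonneg_iff_posSemidef.mpr hH) hr⟩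
  rw [spectrum.zero_mem_iff]
  intro hu
  exact hv (Matrix.mulVec_injective_of_isUnit hu (by simpa using h))

end Matrices


/-! ### The path Hamiltonian with hidden bits -/

/-- The sites: a decoupled ground state `none`, and two copies of a path of `N + 1` vertices. -/
abbrev Site (N : ℕ) : Type := Option (Fin (N + 1) × ZMod 2)

/-- The parity of the first `i` bits. -/
def prefixParity {N : ℕ} (x : Fin N → ZMod 2) (i : ℕ) : ZMod 2 :=
  ∑ k : Fin N, if (k : ℕ) < i then x k else 0

/-- The couplings of the path, those of a spin `N / 2` in a transverse field. -/
def coupling (N i j : ℕ) : ℝ :=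
  (if j = i + 1 then √((i + 1) * (N - i)) else 0) + if i = j + 1 then √((j + 1) * (N - j)) else 0

/-- The hopping matrix: a step from `i` to `i + 1` adds the `i`-th bit to the second label. -/
def hop {N : ℕ} (x : Fin N → ZMod 2) : Matrix (Site N) (Site N) ℝ
  | none, none => -N
  | some (i, s), some (j, s') =>
    if s - prefixParity x i = s' - prefixParity x j then coupling N i j else 0
  | none, some _ => 0
  | some _, none => 0

/-- The Hamiltonian of norm `D`. -/
def hamiltonian (D : ℝ) {N : ℕ} (x : Fin N → ZMod 2) : Matrix (Site N) (Site N) ℂ :=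
  ((D / (2 * N) : ℝ) : ℂ) • (((N : ℝ) : ℂ) • 1 + (hop x).map Complex.ofReal)

/-- The square roots of the binomial coefficients. -/
def amp (N i : ℕ) : ℝ := √(N.choose i)

/-! ### Binomial amplitudes and the action of hopping. -/

lemma amp_pos {N i : ℕ} (h : i ≤ N) : 0 < amp N i :=
  Real.sqrt_pos.mpr (by exact_mod_cast Nat.choose_pos h)

lemma coupling_comm (N i j : ℕ) : coupling N i j = coupling N j i := add_comm _ _

lemma coupling_nonneg (N i j : ℕ) : 0 ≤ coupling N i j := by
  unfold coupling
  positivity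

lemma choose_succ_mul_real {N i : ℕ} (h : i ≤ N) :
    (N.choose (i + 1) : ℝ) * (i + 1) = N.choose i * (N - i) := by
  have := Nat.choose_succ_right_eq N i
  rw [← Nat.cast_sub h]
  exact_mod_cast this

lemma sqrt_mul_amp_succ {N i : ℕ} (h : i ≤ N) :
    √((i + 1) * (N - i)) * amp N (i + 1) = (N - i) * amp N i := by
  have hN : (0 : ℝ) ≤ N - i := sub_nonneg.mpr (by exact_mod_cast h)
  rw [amp, amp, ← Real.sqrt_mul (by positivity)]
  rw [show ((i : ℝ) + 1) * (N - i) * (N.choose (i + 1)) = (N - i) ^ 2 * N.choose i by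
    linear_combination ((N : ℝ) - i) * choose_succ_mul_real h]
  rw [Real.sqrt_mul (sq_nonneg _), Real.sqrt_sq hN]

lemma sqrt_mul_amp {N i : ℕ} (h : i ≤ N) :
    √((i + 1) * (N - i)) * amp N i = (i + 1) * amp N (i + 1) := by
  have hN : (0 : ℝ) ≤ N - i := sub_nonneg.mpr (by exact_mod_cast h)
  rw [amp, amp, ← Real.sqrt_mul (by positivity)]
  rw [show ((i : ℝ) + 1) * (N - i) * (N.choose i) = (i + 1) ^ 2 * N.choose (i + 1) by
    linear_combination -((i : ℝ) + 1) * choose_succ_mul_real h]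
  rw [Real.sqrt_mul (sq_nonneg _), Real.sqrt_sq (by positivity)]

/-- Factoring out binomial amplitudes turns the square-root couplings into integer coefficients.
These vanish at both ends of the path, so the values `f (N + 1)` and, for `i = 0`, the truncated `f
(i - 1)` are harmless. -/
lemma sum_coupling_mul {N : ℕ} (i : Fin (N + 1)) (f : ℕ → ℂ) :
    ∑ j : Fin (N + 1), (coupling N i j : ℂ) * (amp N j * f j) =
      amp N i * ((N - i) * f (i + 1) + i * f (i - 1)) := by
  obtain ⟨i, hi⟩ := i
  simp only
  have hi' : i ≤ N := by omega
  rw [Fin.sum_univ_eq_sum_range (fun j => (coupling N i j : ℂ) * (amp N j * f j))]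
  have hadd : ∀ a b c : ℂ, (a + b) * c = a * c + b * c := add_mul
  simp only [coupling, Complex.ofReal_add, hadd, Finset.sum_add_distrib]
  have h1 : ∑ j ∈ Finset.range (N + 1),
      ((if j = i + 1 then √((i + 1) * (N - i)) else 0 : ℝ) : ℂ) * (amp N j * f j) =
      (N - i) * amp N i * f (i + 1) := by
    simp only [apply_ite Complex.ofReal, ite_mul, Complex.ofReal_zero, zero_mul,
      Finset.sum_ite_eq', Finset.mem_range]
    split_ifs with h
    · rw [← mul_assoc, ← Complex.ofReal_mul, sqrt_mul_amp_succ hi']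
      push_cast
      ring
    · have : i = N := by omega
      simp [this]
  have h2 : ∑ j ∈ Finset.range (N + 1),
      ((if i = j + 1 then √((j + 1) * (N - j)) else 0 : ℝ) : ℂ) * (amp N j * f j) =
      i * amp N i * f (i - 1) := by
    cases i with
    | zero => simp
    | succ i =>
      simp only [apply_ite Complex.ofReal, ite_mul, Complex.ofReal_zero, zero_mul,
        Nat.add_right_cancel_iff, Finset.sum_ite_eq, Finset.mem_range]
      rw [if_pos (by omega), ← mul_assoc, ← Complex.ofReal_mul, sqrt_mul_amp (by omega)]
      push_cast
      simp
  rw [h1, h2]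
  ring

/-- The vectors whose amplitudes are a function of the vertex times a function of the label,
relative to the hidden parity. -/
def siteVec {N : ℕ} (x : Fin N → ZMod 2) (z : ℂ) (f : ℕ → ℂ) (h : ZMod 2 → ℂ) : Site N → ℂ
  | none => z
  | some (j, s) => amp N j * f j * h (s - prefixParity x j)

/-- Measuring the label relative to the prefix parity is a gauge change that removes the hidden bits
from the dynamics. -/
lemma hop_mulVec_siteVec {N : ℕ} (x : Fin N → ZMod 2) (z : ℂ) (f : ℕ → ℂ) (h : ZMod 2 → ℂ) :
    (hop x).map Complex.ofReal *ᵥ siteVec x z f h =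
      siteVec x (-N * z) (fun i => (N - i) * f (i + 1) + i * f (i - 1)) h := by
  funext a
  rcases a with _ | ⟨i, s⟩
  · simp [Matrix.mulVec, dotProduct, Fintype.sum_option, hop, siteVec]
  · simp only [Matrix.mulVec, dotProduct, Fintype.sum_option, hop, siteVec, Matrix.map_apply,
      Complex.ofReal_zero, zero_mul, zero_add, Fintype.sum_prod_type]
    rw [← sum_coupling_mul, Finset.sum_mul]
    refine Finset.sum_congr rfl fun j _ => ?_
    -- At each vertex `j` exactly one label is compatible with the twist.
    rw [Finset.sum_eq_single (s - prefixParity x i + prefixParity x j)]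
    · simp [mul_assoc]
    · intro s' _ hs'
      rw [if_neg]
      · simp
      · intro h
        exact hs' (by rw [h]; ring)
    · simp

lemma hop_apply_comm {N : ℕ} (x : Fin N → ZMod 2) (a b : Site N) : hop x a b = hop x b a := by
  rcases a with _ | ⟨i, s⟩ <;> rcases b with _ | ⟨j, s'⟩ <;> simp [hop]
  rw [coupling_comm]
  simp only [eq_comm]

/-! ### Spectral bounds. -/

lemma isHermitian_hop {N : ℕ} (x : Fin N → ZMod 2) :
    ((hop x).map Complex.ofReal).IsHermitian := by
  ext a b
  simp [hop_apply_comm x a b]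

/-- A positive Perron vector for the entrywise absolute value: on the path the coefficients `N - i`
and `i` add up to `N`, and the ground site has modulus `N`. Schur's test then bounds `hop x` by `N`
on both sides. -/
lemma sum_norm_hop_mul {N : ℕ} (x : Fin N → ZMod 2) (a : Site N) :
    ∑ b, ‖(hop x).map Complex.ofReal a b‖ * (siteVec x 1 1 1 b).re =
      N * (siteVec x 1 1 1 a).re := by
  have hre : ∀ b, ((siteVec x 1 1 1 b).re : ℂ) = siteVec x 1 1 1 b := by
    rintro (_ | ⟨j, s⟩) <;> simp [siteVec]
  rw [← Complex.ofReal_inj]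
  push_cast
  simp only [hre]
  rcases a with _ | ⟨i, s⟩
  · simp [Fintype.sum_option, hop, siteVec]
  · have h := congrFun (hop_mulVec_siteVec x 1 1 1) (some (i, s))
    have h2 : ∀ b, ((‖(hop x).map Complex.ofReal (some (i, s)) b‖ : ℝ) : ℂ) =
        (hop x).map Complex.ofReal (some (i, s)) b := by
      rintro (_ | ⟨j, s'⟩)
      · simp [hop]
      · simp only [Matrix.map_apply, Complex.norm_real, hop, Real.norm_eq_abs]
        rw [abs_of_nonneg]
        split_ifs
        · exact coupling_nonneg _ _ _
        · rfl
    simp only [h2]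
    refine h.trans ?_
    simp [siteVec]
    ring

lemma siteVec_one_re_pos {N : ℕ} (x : Fin N → ZMod 2) (a : Site N) :
    0 < (siteVec x 1 1 1 a).re := by
  rcases a with _ | ⟨i, s⟩
  · simp [siteVec]
  · simpa [siteVec] using amp_pos (by omega)

lemma posSemidef_hamiltonian {D : ℝ} (hD : 0 ≤ D) {N : ℕ} (x : Fin N → ZMod 2) :
    (hamiltonian D x).PosSemidef := by
  refine (posSemidef_smul_one_add (isHermitian_hop x) (siteVec_one_re_pos x)
    fun a => (sum_norm_hop_mul x a).le).smul ?_
  rw [Complex.zero_le_real]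
  positivity

lemma posSemidef_smul_one_sub_hamiltonian {D : ℝ} (hD : 0 ≤ D) {N : ℕ} (hN : 0 < N)
    (x : Fin N → ZMod 2) :
    ((D : ℂ) • (1 : Matrix (Site N) (Site N) ℂ) - hamiltonian D x).PosSemidef := by
  have h := (posSemidef_smul_one_add (isHermitian_hop x).neg (siteVec_one_re_pos x)
    fun a => by simpa using (sum_norm_hop_mul x a).le).smul
      (α := ℂ) (a := ((D / (2 * N) : ℝ) : ℂ)) (by rw [Complex.zero_le_real]; positivity)
  convert h using 1
  have hN' : (N : ℂ) ≠ 0 := by exact_mod_cast hN.ne'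
  have h1 : (D : ℂ) = ((D / (2 * N) : ℝ) : ℂ) * N + ((D / (2 * N) : ℝ) : ℂ) * N := by
    push_cast
    field_simp
    norm_num
  nth_rewrite 1 [h1]
  rw [hamiltonian]
  simp only [Complex.ofReal_natCast]
  module

lemma hamiltonian_mulVec_siteVec {D : ℝ} {N : ℕ} (x : Fin N → ZMod 2) (z : ℂ)
    (f : ℕ → ℂ) (h : ZMod 2 → ℂ) :
    hamiltonian D x *ᵥ siteVec x z f h = siteVec x 0
      (fun i => D / (2 * N) * (N * f i + (N - i) * f (i + 1) + i * f (i - 1))) h := by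
  rw [hamiltonian, Matrix.smul_mulVec, Matrix.add_mulVec, Matrix.smul_mulVec, Matrix.one_mulVec,
    hop_mulVec_siteVec]
  funext a
  rcases a with _ | ⟨i, s⟩
  · simp [siteVec]
  · simp [siteVec]
    ring

/-! ### Explicit dynamics. -/

/-- The rotated spin state. -/
def rotated (N : ℕ) (θ : ℝ) (i : ℕ) : ℂ :=
  Real.cos θ ^ (N - i) * (-Complex.I * Real.sin θ) ^ i

lemma hasDerivAt_rotated {N i : ℕ} (hi : i ≤ N) (θ : ℝ) :
    HasDerivAt (fun θ => rotated N θ i)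
      (-Complex.I * ((N - i) * rotated N θ (i + 1) + i * rotated N θ (i - 1))) θ := by
  have hc := (Real.hasDerivAt_cos θ).ofReal_comp.pow (N - i)
  have hs := ((Real.hasDerivAt_sin θ).ofReal_comp.const_mul (-Complex.I)).pow i
  have h := hc.mul hs
  refine HasDerivAt.congr_deriv (f := fun θ => rotated N θ i) h ?_
  rw [← Nat.cast_sub hi]
  simp only [rotated, Pi.pow_apply]
  rcases Nat.eq_zero_or_pos i with rfl | hi0
  · rcases Nat.eq_zero_or_pos N with rfl | hN0
    · simp
    · simp
      linear_combination (-(N : ℂ) * Complex.cos θ ^ (N - 1) * Complex.sin θ) * Complex.I_sq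
  · obtain ⟨i, rfl⟩ : ∃ k, i = k + 1 := ⟨i - 1, by omega⟩
    have h1 : N - (i + 1 + 1) = N - (i + 1) - 1 := by omega
    have h2 : N - (i + 1 - 1) = N - (i + 1) + 1 := by omega
    rw [h1, h2]
    simp only [Nat.add_sub_cancel]
    push_cast
    linear_combination (-((N - (i + 1) : ℕ) : ℂ) * Complex.cos θ ^ (N - (i + 1) - 1) *
      Complex.sin θ * (-Complex.I * Complex.sin θ) ^ (i + 1)) * Complex.I_sq


/-! ### Locality of the rows, sparsity and extremal eigenvectors. -/

lemma prefixParity_zero {N : ℕ} (x : Fin N → ZMod 2) : prefixParity x 0 = 0 := by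
  simp [prefixParity]

lemma prefixParity_self {N : ℕ} (x : Fin N → ZMod 2) : prefixParity x N = ∑ k, x k := by
  simp [prefixParity]

lemma prefixParity_succ {N k : ℕ} (x : Fin N → ZMod 2) (hk : k < N) :
    prefixParity x (k + 1) = prefixParity x k + x ⟨k, hk⟩ := by
  rw [prefixParity, prefixParity, ← Fintype.sum_ite_eq' (⟨k, hk⟩ : Fin N) x,
    ← Finset.sum_add_distrib]
  refine Finset.sum_congr rfl fun j _ => ?_
  have h : j = ⟨k, hk⟩ ↔ (j : ℕ) = k := Fin.ext_iff
  simp only [h]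
  split_ifs <;> first | omega | simp

lemma coupling_eq_zero {N i j : ℕ} (h1 : j ≠ i + 1) (h2 : i ≠ j + 1) : coupling N i j = 0 := by
  simp [coupling, h1, h2]

/-- The bits on which a row of the Hamiltonian depends. -/
def rowBits (N : ℕ) : Site N → Finset (Fin N)
  | none => ∅
  | some (i, _) => Finset.univ.filter fun k => (k : ℕ) = i ∨ (k : ℕ) + 1 = i

lemma card_rowBits_le {N : ℕ} (a : Site N) : (rowBits N a).card ≤ 2 := by
  rcases a with _ | ⟨i, s⟩
  · simp [rowBits]
  · refine (Finset.card_le_card_of_injOn (t := {(i : ℕ), (i : ℕ) - 1}) (Fin.val : Fin N → ℕ) ?_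
      Fin.val_injective.injOn).trans Finset.card_le_two
    intro k hk
    simp only [rowBits, Finset.coe_filter, Finset.mem_univ, true_and, Set.mem_ofPred_eq] at hk
    simp only [Finset.coe_insert, Finset.coe_singleton, Set.mem_insert_iff, Set.mem_singleton_iff]
    omega

/-- Prefix parities involve many bits, but an entry sees only their difference at neighbouring
vertices, which is a single bit. -/
lemma dependsOn_hop {N : ℕ} (a b : Site N) :
    DependsOn (fun x : Fin N → ZMod 2 => hop x a b) (rowBits N a : Set (Fin N)) := by
  intro x y hxy
  rcases a with _ | ⟨i, s⟩ <;> rcases b with _ | ⟨j, s'⟩ <;> simp only [hop]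
  by_cases h1 : (j : ℕ) = i + 1
  · have hi : (i : ℕ) < N := by omega
    have h := hxy ⟨i, hi⟩ (by simp [rowBits])
    have key : ∀ u v w z : ZMod 2, u - w = v - (w + z) ↔ u = v - z := by decide
    rw [h1, prefixParity_succ x hi, prefixParity_succ y hi, h]
    simp only [key]
  by_cases h2 : (i : ℕ) = j + 1
  · have hj : (j : ℕ) < N := by omega
    have h := hxy ⟨j, hj⟩ (by simp [rowBits, h2])
    have key : ∀ u v w z : ZMod 2, u - (w + z) = v - w ↔ u - z = v := by decide
    rw [h2, prefixParity_succ x hj, prefixParity_succ y hj, h]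
    simp only [key]
  simp [coupling_eq_zero h1 h2]

lemma ncard_hop_ne_zero_le {N : ℕ} (x : Fin N → ZMod 2) (a : Site N) :
    {b | hop x a b ≠ 0}.ncard ≤ 2 := by
  rcases a with _ | ⟨i, s⟩
  · refine (Set.ncard_le_ncard (t := {none}) ?_).trans (by simp)
    rintro (_ | ⟨j, s'⟩) hb
    · rfl
    · exact absurd rfl hb
  · have hb : ∀ b, hop x (some (i, s)) b ≠ 0 → ∃ j s', b = some (j, s') ∧
        ((j : ℕ) = i + 1 ∨ (i : ℕ) = j + 1) ∧
        s - prefixParity x i = s' - prefixParity x j := by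
      rintro (_ | ⟨j, s'⟩) hb
      · exact absurd rfl hb
      · refine ⟨j, s', rfl, ?_, ?_⟩
        · by_contra! h
          simp [hop, coupling_eq_zero h.1 h.2] at hb
        · by_contra h
          simp [hop, h] at hb
    -- The vertex determines the label through the twist, so counting vertices suffices. The default
    -- 0 at `none` plays no role, since that entry vanishes.
    let g : Site N → ℕ := fun b => b.elim 0 fun p => (p.1 : ℕ)
    refine (Set.ncard_le_ncard_of_injOn (t := {(i : ℕ) + 1, (i : ℕ) - 1}) g ?_ ?_).trans
      (by rw [← Finset.coe_pair, Set.ncard_coe_finset]; exact Finset.card_le_two)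
    · intro b h
      obtain ⟨j, s', rfl, h, -⟩ := hb b h
      simp only [g, Option.elim_some, Set.mem_insert_iff, Set.mem_singleton_iff]
      omega
    · intro b h b' h' hg
      obtain ⟨j, s1, rfl, -, h1⟩ := hb b h
      obtain ⟨j', s2, rfl, -, h2⟩ := hb b' h'
      obtain rfl : j = j' := Fin.ext hg
      rw [h1] at h2
      rw [sub_left_inj.mp h2]

lemma siteVec_ne_zero {N : ℕ} (x : Fin N → ZMod 2) : siteVec x 0 1 1 ≠ 0 := fun h => by
  simpa [siteVec, amp] using congrFun h (some (0, 0))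

lemma hamiltonian_mulVec_siteVec_one {D : ℝ} {N : ℕ} (hN : 0 < N) (x : Fin N → ZMod 2) :
    hamiltonian D x *ᵥ siteVec x 0 1 1 = (D : ℂ) • siteVec x 0 1 1 := by
  have hN' : (N : ℂ) ≠ 0 := by exact_mod_cast hN.ne'
  rw [hamiltonian_mulVec_siteVec]
  funext a
  rcases a with _ | ⟨i, s⟩
  · simp [siteVec]
  · simp [siteVec]
    field_simp
    ring

lemma hamiltonian_mulVec_ground {D : ℝ} {N : ℕ} (x : Fin N → ZMod 2) :
    hamiltonian D x *ᵥ Pi.single none 1 = 0 := by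
  have h := hamiltonian_mulVec_siteVec (D := D) x 1 0 0
  have h1 : siteVec x 1 0 0 = Pi.single none 1 := by
    funext a
    rcases a with _ | ⟨i, s⟩ <;> simp [siteVec]
  rw [h1] at h
  rw [h]
  funext a
  rcases a with _ | ⟨i, s⟩ <;> simp [siteVec]

/-! ### Transfer to `Fin n`, the input state and the query bound. -/

section Reindexed

variable {n N : ℕ} (e : Fin n ≃ Site N)

lemma submatrix_mulVec_comp (M : Matrix (Site N) (Site N) ℂ) (v : Site N → ℂ) :
    M.submatrix e e *ᵥ (v ∘ e) = (M *ᵥ v) ∘ e := by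
  rw [Matrix.submatrix_mulVec_equiv]
  congr 2
  funext a
  simp

lemma comp_ne_zero {v : Site N → ℂ} (hv : v ≠ 0) : v ∘ e ≠ 0 := fun h => hv <| by
  funext a
  simpa using congrFun h (e.symm a)

lemma isTwoSparse_submatrix {D : ℝ} (hN : 0 < N) (x : Fin N → ZMod 2) :
    IsTwoSparse ((hamiltonian D x).submatrix e e) := by
  have hN' : (N : ℂ) ≠ 0 := by exact_mod_cast hN.ne'
  -- The shift `D / 2` cancels the identity term and leaves a multiple of `hop x`.
  refine ⟨D / 2, fun r => ?_⟩
  refine (Set.ncard_le_ncard_of_injOn (t := {b | hop x (e r) b ≠ 0}) e ?_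
    e.injective.injOn).trans (ncard_hop_ne_zero_le x (e r))
  intro q hq hop0
  refine hq ?_
  simp only [Matrix.sub_apply, Matrix.submatrix_apply, hamiltonian, Matrix.smul_apply,
    Matrix.add_apply, Matrix.map_apply, hop0, Matrix.one_apply, e.injective.eq_iff]
  split_ifs
  · simp
    field_simp
    ring
  · simp

lemma isTwoSparse_posSemidef_norm_spectrum {D : ℝ} (hD : 0 < D) (hN : 0 < N) (x : Fin N → ZMod 2) :
    IsTwoSparse ((hamiltonian D x).submatrix e e) ∧
      ((hamiltonian D x).submatrix e e).PosSemidef ∧ ‖(hamiltonian D x).submatrix e e‖ = D ∧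
        IsLeast (spectrum ℝ ((hamiltonian D x).submatrix e e)) 0 := by
  have hpos := (posSemidef_hamiltonian hD.le x).submatrix e
  refine ⟨isTwoSparse_submatrix e hN x, hpos, le_antisymm ?_ ?_, ?_⟩
  · refine l2_opNorm_le_of_posSemidef hpos hD.le ?_
    have h := (posSemidef_smul_one_sub_hamiltonian hD.le hN x).submatrix e
    have h1 : ((D : ℂ) • (1 : Matrix (Site N) (Site N) ℂ)).submatrix e e = (D : ℂ) • 1 := by
      rw [← Matrix.submatrix_one_equiv e]
      rfl
    rw [← h1]
    exact h
  · refine le_l2_opNorm_of_mulVec_eq (comp_ne_zero e (siteVec_ne_zero x)) ?_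
    rw [submatrix_mulVec_comp, hamiltonian_mulVec_siteVec_one hN]
    rfl
  · refine isLeast_spectrum_zero hpos (comp_ne_zero e (v := Pi.single none 1) (by simp)) ?_
    rw [submatrix_mulVec_comp, hamiltonian_mulVec_ground]
    rfl

/-- The occupation probabilities of the input state. -/
def weight (N : ℕ) (p : ℝ) (a : Site N) : ℝ :=
  (if a = none then 1 - p else 0) + if a = some (0, 0) then p else 0

/-- The input state: a mixture of the ground state and of the start of the path. -/
def inputState (p : ℝ) : Matrix (Fin n) (Fin n) ℂ :=
  Matrix.diagonal fun r => (weight N p (e r) : ℂ)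

lemma sum_mul_weight (p : ℝ) (f : Fin n → ℂ) : ∑ r, f r * (weight N p (e r) : ℂ) =
    (1 - p) * f (e.symm none) + p * f (e.symm (some (0, 0))) := by
  rw [← e.symm.sum_comp]
  simp only [weight, Equiv.apply_symm_apply, Complex.ofReal_add, mul_add, Finset.sum_add_distrib,
    apply_ite Complex.ofReal, mul_ite, Complex.ofReal_zero, mul_zero, Finset.sum_ite_eq',
    Finset.mem_univ, if_true]
  push_cast
  ring

lemma isState_inputState {p : ℝ} (h0 : 0 ≤ p) (h1 : p ≤ 1) : IsState (inputState e p) := by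
  constructor
  · refine Matrix.PosSemidef.diagonal fun r => ?_
    rw [Pi.zero_apply, Complex.zero_le_real, weight]
    have := sub_nonneg.mpr h1
    positivity
  · have h := sum_mul_weight e p 1
    simp only [Pi.one_apply, one_mul, mul_one] at h
    rw [inputState, Matrix.trace_diagonal, h]
    ring

lemma energy_inputState (D p : ℝ) (hN : 0 < N) (x : Fin N → ZMod 2) :
    energy ((hamiltonian D x).submatrix e e) (inputState e p) = p * D / 2 := by
  have hN' : (N : ℝ) ≠ 0 := by exact_mod_cast hN.ne'
  have h := sum_mul_weight e p fun r => hamiltonian D x (e r) (e r)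
  have h2 : ((hamiltonian D x).submatrix e e * inputState e p).trace =
      ∑ r, hamiltonian D x (e r) (e r) * (weight N p (e r) : ℂ) := by
    simp [Matrix.trace, inputState, Matrix.mul_diagonal]
  have h3 : hamiltonian D x none none = ((0 : ℝ) : ℂ) := by simp [hamiltonian, hop]
  have h4 : hamiltonian D x (some (0, 0)) (some (0, 0)) = ((D / 2 : ℝ) : ℂ) := by
    have : coupling N 0 0 = 0 := coupling_eq_zero (by simp) (by simp)
    simp only [hamiltonian, hop, Matrix.smul_apply, Matrix.add_apply, Matrix.one_apply_eq,
      Matrix.map_apply, if_true, Fin.val_zero, this, smul_eq_mul]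
    rw [Complex.ofReal_zero, add_zero, mul_one, ← Complex.ofReal_mul]
    congr 1
    field_simp
  rw [energy, h2, h, Equiv.apply_symm_apply, Equiv.apply_symm_apply, h3, h4,
    ← Complex.ofReal_one, ← Complex.ofReal_sub, ← Complex.ofReal_mul, ← Complex.ofReal_mul,
    ← Complex.ofReal_add, Complex.ofReal_re]
  ring

lemma propagator_mulVec_ground (D t : ℝ) (x : Fin N → ZMod 2) :
    propagator ((hamiltonian D x).submatrix e e) t *ᵥ (Pi.single none 1 ∘ e) =
      (Pi.single none 1 : Site N → ℂ) ∘ e := by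
  refine propagator_mulVec_of_hasDerivAt _ (fun _ => (Pi.single none 1 : Site N → ℂ) ∘ e)
    (fun t => ?_) t
  rw [submatrix_mulVec_comp, hamiltonian_mulVec_ground]
  exact (hasDerivAt_const t _).congr_deriv (by funext r; simp)

/-- The state at time `t` of the particle started at the beginning of the path. -/
def wave (D : ℝ) (x : Fin N → ZMod 2) (t : ℝ) : Site N → ℂ :=
  Complex.exp (-(Complex.I * (D / 2)) * t) •
    siteVec x 0 (rotated N (D / (2 * N) * t)) (Pi.single 0 1)

lemma wave_zero (D : ℝ) (x : Fin N → ZMod 2) : wave D x 0 = Pi.single (some (0, 0)) 1 := by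
  funext a
  rcases a with _ | ⟨i, s⟩
  · simp [wave, siteVec]
  · by_cases hi : i = 0
    · subst hi
      by_cases hs : s = 0
      · subst hs
        simp [wave, siteVec, rotated, prefixParity_zero, amp]
      · simp [wave, siteVec, prefixParity_zero, hs]
    · have : (i : ℕ) ≠ 0 := fun h => hi (Fin.ext h)
      simp [wave, siteVec, rotated, this, hi]

lemma hasDerivAt_wave (D : ℝ) (hN : 0 < N) (x : Fin N → ZMod 2) (t : ℝ) (a : Site N) :
    HasDerivAt (fun t => wave D x t a) (-Complex.I * (hamiltonian D x *ᵥ wave D x t) a) t := by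
  have hN' : (N : ℂ) ≠ 0 := by exact_mod_cast hN.ne'
  have hexp : HasDerivAt (fun t : ℝ => Complex.exp (-(Complex.I * (D / 2)) * t))
      (Complex.exp (-(Complex.I * (D / 2)) * t) * (-(Complex.I * (D / 2)) * 1)) t :=
    ((Complex.ofRealCLM.hasDerivAt (x := t)).const_mul _).cexp
  simp only [wave, Matrix.mulVec_smul, hamiltonian_mulVec_siteVec]
  rcases a with _ | ⟨i, s⟩
  · simpa [siteVec] using hasDerivAt_const t (0 : ℂ)
  · have hlin : HasDerivAt (fun t : ℝ => D / (2 * N) * t) (D / (2 * N) : ℝ) t := by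
      simpa using (hasDerivAt_id t).const_mul (D / (2 * N) : ℝ)
    have hrot := (hasDerivAt_rotated (N := N) (i := i) (by omega) (D / (2 * N) * t)).scomp t hlin
    have h := hexp.mul ((hrot.const_mul (amp N i : ℂ)).mul_const
      ((Pi.single 0 1 : ZMod 2 → ℂ) (s - prefixParity x i)))
    refine HasDerivAt.congr_deriv (f := fun t : ℝ => Complex.exp (-(Complex.I * (D / 2)) * t) *
      ((amp N i * rotated N (D / (2 * N) * t) i) *
        (Pi.single 0 1 : ZMod 2 → ℂ) (s - prefixParity x i))) h ?_
    simp only [Pi.smul_apply, siteVec, smul_eq_mul, Function.comp_apply, Complex.real_smul]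
    push_cast
    field_simp
    ring

lemma propagator_mulVec_start (D t : ℝ) (hN : 0 < N) (x : Fin N → ZMod 2) :
    propagator ((hamiltonian D x).submatrix e e) t *ᵥ (Pi.single (some (0, 0)) 1 ∘ e) =
      wave D x t ∘ e := by
  rw [← wave_zero D x]
  refine propagator_mulVec_of_hasDerivAt _ (fun t => wave D x t ∘ e) (fun t => ?_) t
  rw [submatrix_mulVec_comp, hasDerivAt_pi]
  exact fun r => hasDerivAt_wave D hN x t (e r)

/-- The diagonal input involves only two columns of the propagator. The ground column never reaches
the path; the other is the explicit wave, whose binomial factor at the last vertex is 1. -/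
lemma evolved_inputState_apply (D p t : ℝ) (hN : 0 < N) (x : Fin N → ZMod 2) (s : ZMod 2) :
    evolved ((hamiltonian D x).submatrix e e) t (inputState e p)
        (e.symm (some (Fin.last N, s))) (e.symm (some (Fin.last N, s))) =
      if s = ∑ k, x k then ((p * Real.sin (D / (2 * N) * t) ^ (2 * N) : ℝ) : ℂ) else 0 := by
  set V := propagator ((hamiltonian D x).submatrix e e) t with hV
  set r := e.symm (some (Fin.last N, s)) with hr
  have hsing : ∀ a : Site N, (Pi.single a 1 : Site N → ℂ) ∘ e = Pi.single (e.symm a) 1 := by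
    intro a
    funext q
    simp [Pi.single_apply, Equiv.eq_symm_apply]
  have hg : V r (e.symm none) = 0 := by
    have h := congrFun (propagator_mulVec_ground e D t x) r
    rw [hsing, Matrix.mulVec_single_one] at h
    rw [← hV] at h
    simpa [hr, Pi.single_apply] using h
  have ho : V r (e.symm (some (0, 0))) = wave D x t (some (Fin.last N, s)) := by
    have h := congrFun (propagator_mulVec_start e D t hN x) r
    rw [hsing, Matrix.mulVec_single_one] at h
    rw [← hV] at h
    simpa [hr] using h
  have h1 : evolved ((hamiltonian D x).submatrix e e) t (inputState e p) r r =
      ∑ q, (V r q * star (V r q)) * (weight N p (e q) : ℂ) := by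
    rw [evolved, ← hV, inputState, Matrix.mul_apply]
    refine Finset.sum_congr rfl fun q _ => ?_
    rw [Matrix.mul_diagonal, Matrix.conjTranspose_apply]
    ring
  rw [h1, sum_mul_weight, hg, ho]
  have h2 : ‖Complex.exp (-(Complex.I * (D / 2)) * t)‖ = 1 := by
    rw [show (-(Complex.I * (D / 2)) * t : ℂ) = ((-(D / 2 * t) : ℝ) : ℂ) * Complex.I by
      push_cast; ring]
    exact Complex.norm_exp_ofReal_mul_I _
  have h3 : ∀ z : ℂ, z * star z = ((‖z‖ ^ 2 : ℝ) : ℂ) := fun z => by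
    rw [Complex.star_def, Complex.mul_conj']
    push_cast
    rfl
  rw [h3, h3, wave, Pi.smul_apply, smul_eq_mul, norm_mul, h2]
  simp only [siteVec, Fin.val_last, prefixParity_self, amp, Nat.choose_self, Pi.single_apply,
    sub_eq_zero, rotated, Nat.sub_self]
  split_ifs
  · simp only [Nat.cast_one, Real.sqrt_one, Complex.ofReal_one, pow_zero, one_mul, mul_one,
      norm_pow, norm_mul, norm_neg, Complex.norm_I, Complex.norm_real, Real.norm_eq_abs,
      norm_zero, ← pow_mul, mul_comm N 2, Even.pow_abs (even_two_mul N)]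
    simp
  · simp

/-- Each population at the end is off by at most `ε`, so a signal above `2 * ε` keeps the sign of
their difference. -/
lemma le_queries (A : QueryAlgorithm n) (D p t ε : ℝ) (hN : 0 < N)
    (hε : 2 * ε < p * Real.sin (D / (2 * N) * t) ^ (2 * N))
    (hsim : ∀ x : Fin N → ZMod 2,
      A.Simulates ((hamiltonian D x).submatrix e e) (inputState e p) t ε) :
    N ≤ 4 * A.queries := by
  have h := A.card_le_of_parity (κ := Fin N) (d := 2)
    (H := fun x => (hamiltonian D x).submatrix e e)
    (S := fun r => rowBits N (e r)) (fun r => card_rowBits_le _)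
    (fun r x y hxy => by
      funext q
      simp only [Matrix.submatrix_apply, hamiltonian, Matrix.smul_apply, Matrix.add_apply,
        Matrix.map_apply]
      rw [show hop x (e r) (e q) = hop y (e r) (e q) from dependsOn_hop _ _ hxy])
    (inputState e p) (e.symm (some (Fin.last N, 0))) (e.symm (some (Fin.last N, 1))) fun x => ?_
  · simpa using h
  have hs : ∀ s : ZMod 2, |(A.channel ((hamiltonian D x).submatrix e e) (inputState e p)
        (e.symm (some (Fin.last N, s))) (e.symm (some (Fin.last N, s)))).re -
      if s = ∑ k, x k then p * Real.sin (D / (2 * N) * t) ^ (2 * N) else 0| ≤ ε := fun s => by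
    have h := (norm_apply_le_l2_opNorm _ (e.symm (some (Fin.last N, s)))
      (e.symm (some (Fin.last N, s)))).trans (hsim x)
    rw [Matrix.sub_apply, evolved_inputState_apply e D p t hN x s] at h
    have h2 := (Complex.abs_re_le_norm _).trans h
    rw [Complex.sub_re, apply_ite Complex.re, Complex.ofReal_re, Complex.zero_re] at h2
    exact h2
  have h0 := abs_le.mp (hs 0)
  have h1 := abs_le.mp (hs 1)
  generalize ∑ k, x k = y at h0 h1 ⊢
  have hy : y = 0 ∨ y = 1 := by clear h0 h1 hs; revert y; decide
  rcases hy with rfl | rfl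
  · simp [sign] at h0 h1 ⊢
    linarith
  · simp [sign] at h0 h1 ⊢
    linarith

end Reindexed

/-- The family of Hamiltonians of norm `D` and dimension `n`. -/
def family (D : ℝ) (n : ℕ) : Set (Matrix (Fin n) (Fin n) ℂ) :=
  {H | ∃ N : ℕ, 0 < N ∧ ∃ h : Fintype.card (Site N) = n, ∃ x : Fin N → ZMod 2,
    H = (hamiltonian D x).submatrix (Fintype.equivFinOfCardEq h).symm
      (Fintype.equivFinOfCardEq h).symm}

/-- The dimension `2 * N + 3` determines `N`, so one input state serves the whole family in that
dimension. -/
lemma mem_family_card {D : ℝ} {N : ℕ}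
    {H : Matrix (Fin (Fintype.card (Site N))) (Fin (Fintype.card (Site N))) ℂ} (hN : 0 < N) :
    H ∈ family D (Fintype.card (Site N)) ↔ ∃ x : Fin N → ZMod 2,
      H = (hamiltonian D x).submatrix (Fintype.equivFinOfCardEq rfl).symm
        (Fintype.equivFinOfCardEq rfl).symm := by
  constructor
  · rintro ⟨M, -, h, x, rfl⟩
    obtain rfl : M = N := by
      simp only [Fintype.card_option, Fintype.card_prod, Fintype.card_fin, ZMod.card] at h
      omega
    exact ⟨x, rfl⟩
  · rintro ⟨x, rfl⟩
    exact ⟨N, hN, rfl, x, rfl⟩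

/-! ### The choice of the length of the path -/

open Real

/-- Rounding up costs only a constant: the power `2 * ⌈A⌉₊` of the ratio is at least `exp (-4)`. For
ceiling at least 2 this follows from `A > ⌈A⌉₊ - 1`; for ceiling 1 from `1 / π ≥ 1 / 4 ≥ exp (-2)`.
-/
lemma exp_neg_le_div_ceil {A : ℝ} (hA : 1 / π ≤ A) :
    exp (-(2 / ⌈A⌉₊)) ≤ A / ⌈A⌉₊ := by
  have hπ := Real.pi_lt_d2
  have hA0 : 0 < A := lt_of_lt_of_le (by positivity) hA
  have hN1 : 1 ≤ ⌈A⌉₊ := Nat.one_le_ceil_iff.mpr hA0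
  have hlt := Nat.ceil_lt_add_one hA0.le
  generalize ⌈A⌉₊ = N at *
  rcases hN1.eq_or_lt with rfl | h
  · have h1 : (1 : ℝ) / 4 ≤ 1 / π := one_div_le_one_div_of_le Real.pi_pos (by linarith)
    have h2 := Real.add_one_le_exp (1 : ℝ)
    have h3 : (4 : ℝ) ≤ exp 2 := by
      rw [show (2 : ℝ) = 1 + 1 by norm_num, Real.exp_add]
      nlinarith
    simp only [Nat.cast_one, div_one, Real.exp_neg]
    calc (exp 2)⁻¹ ≤ (4 : ℝ)⁻¹ := inv_anti₀ (by norm_num) h3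
      _ ≤ A := by norm_num at h1 hA ⊢; linarith
  · have hN : (2 : ℝ) ≤ N := by exact_mod_cast h
    have h1 := Real.add_one_le_exp (2 / (N : ℝ))
    have h2 : (N : ℝ) / (N - 1) ≤ exp (2 / (N : ℝ)) := by
      refine le_trans ?_ h1
      rw [div_le_iff₀ (by linarith)]
      have : (2 / (N : ℝ) + 1) * (N - 1) = N + (1 - 2 / N) := by field_simp; ring
      have h3 : 2 / (N : ℝ) ≤ 1 := by rw [div_le_one (by linarith)]; exact hN
      linarith
    rw [Real.exp_neg]
    calc (exp (2 / (N : ℝ)))⁻¹ ≤ ((N : ℝ) / (N - 1))⁻¹ :=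
          inv_anti₀ (div_pos (by linarith) (by linarith)) h2
      _ = (N - 1) / N := inv_div _ _
      _ ≤ A / N := by gcongr; linarith

lemma exists_path_length {α : ℝ} (hα : 0 < α) (hα1 : α < 1) : ∃ L₀ : ℝ, ∀ L τ : ℝ, L₀ ≤ L →
    1 ≤ τ → ∃ N : ℕ, 0 < N ∧ τ / π ≤ N ∧ α / 8 * (L / log L) ≤ N ∧
      2 * exp (-(α * L)) < sin (τ / (2 * N)) ^ (2 * N) := by
  have hlog : ∀ᶠ L : ℝ in Filter.atTop, ‖log L‖ ≤ α / 8 * ‖id L‖ :=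
    Real.isLittleO_log_id_atTop.bound (by positivity)
  obtain ⟨L₁, hL₁⟩ := Filter.eventually_atTop.mp hlog
  -- `L₁` makes `α / 8 * (L / log L)` at least 1, `exp 1` gives `log L ≥ 1`, and `5 / α` gives `exp
  -- (-4) ≥ exp (-(α * L) + 1)`.
  refine ⟨max L₁ (max (exp 1) (5 / α)), fun L τ hL hτ => ?_⟩
  obtain ⟨h1, h2⟩ := max_le_iff.mp hL
  obtain ⟨h2, h3⟩ := max_le_iff.mp h2
  have hL0 : 0 < L := (Real.exp_pos 1).trans_le h2
  have hlog1 : 1 ≤ log L := (Real.le_log_iff_exp_le hL0).mpr h2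
  have hαL : 5 ≤ α * L := by rwa [div_le_iff₀' hα] at h3
  have hM := hL₁ L h1
  rw [id, Real.norm_of_nonneg (by linarith), Real.norm_of_nonneg hL0.le] at hM
  have hM1 : 1 ≤ α / 8 * (L / log L) := by
    rw [← mul_div_assoc, le_div_iff₀ (by linarith)]
    linarith
  have hπ := Real.pi_lt_d2
  have hτπ : 1 / π ≤ τ / π := by gcongr
  have hτ0 : 0 < τ / π := by positivity
  have htwo : (2 : ℝ) < exp 1 := by
    have := Real.exp_one_gt_d9
    linarith
  set N := max ⌈τ / π⌉₊ ⌈α / 8 * (L / log L)⌉₊ with hNdef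
  have hN1 : τ / π ≤ N := (Nat.le_ceil _).trans (by exact_mod_cast le_max_left _ _)
  have hN2 : α / 8 * (L / log L) ≤ N := (Nat.le_ceil _).trans (by exact_mod_cast le_max_right _ _)
  have hN0 : (0 : ℝ) < N := hτ0.trans_le hN1
  refine ⟨N, by exact_mod_cast hN0, hN1, hN2, ?_⟩
  -- Jordan's inequality `sin y ≥ 2 * y / π` on `[0, π / 2]`; the range is where `N ≥ τ / π` is
  -- needed.
  have hsin : τ / π / N ≤ sin (τ / (2 * N)) := by
    refine le_trans (le_of_eq ?_) (Real.mul_le_sin (x := τ / (2 * N)) (by positivity) ?_)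
    · field_simp
    · rw [div_le_iff₀ Real.pi_pos] at hN1
      rw [div_le_iff₀ (by positivity)]
      linarith
  -- The spare factor `exp 1` absorbs the 2 in the goal. If `τ / π` determines `N`, rounding is the
  -- only loss. Otherwise `π * N ≤ L` bounds the base below by `L⁻¹`, and `2 * N * log L ≤ α * L /
  -- 2`.
  have main : exp (-(α * L) + 1) ≤ (τ / π / N) ^ (2 * N) := by
    rcases max_choice ⌈τ / π⌉₊ ⌈α / 8 * (L / log L)⌉₊ with h | h
    · rw [← hNdef] at h
      have h4 := exp_neg_le_div_ceil hτπ
      rw [← h] at h4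
      calc exp (-(α * L) + 1) ≤ exp (-4) := Real.exp_le_exp.mpr (by linarith)
        _ = exp (-(2 / N)) ^ (2 * N) := by
            rw [← Real.exp_nat_mul]
            congr 1
            push_cast
            field_simp
            norm_num
        _ ≤ _ := pow_le_pow_left₀ (Real.exp_pos _).le h4 _
    · rw [← hNdef] at h
      have hlt := Nat.ceil_lt_add_one (zero_le_one.trans hM1)
      rw [← h] at hlt
      have hN3 : (N : ℝ) ≤ α / 4 * (L / log L) := by linarith
      have hML : L / log L ≤ L := div_le_self hL0.le hlog1
      have hNL : π * N ≤ L := by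
        have h5 : α * (L / log L) ≤ 1 * L := by gcongr
        nlinarith
      calc exp (-(α * L) + 1) ≤ exp (-(log L) * (2 * N)) := by
            refine Real.exp_le_exp.mpr ?_
            have h6 : log L * N ≤ log L * (α / 4 * (L / log L)) := by gcongr
            have h7 : log L * (α / 4 * (L / log L)) = α * L / 4 := by field_simp
            linarith
        _ = (L⁻¹) ^ (2 * N) := by
            rw [mul_comm, ← Nat.cast_ofNat (n := 2), ← Nat.cast_mul, Real.exp_nat_mul,
              Real.exp_neg, Real.exp_log hL0]
        _ ≤ _ := by
            refine pow_le_pow_left₀ (by positivity) ?_ _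
            calc L⁻¹ ≤ (π * N)⁻¹ := inv_anti₀ (by positivity) hNL
              _ = 1 / π / N := by field_simp
              _ ≤ _ := by gcongr
  calc 2 * exp (-(α * L)) < exp 1 * exp (-(α * L)) := by gcongr
    _ = exp (-(α * L) + 1) := by rw [← Real.exp_add, add_comm]
    _ ≤ _ := main
    _ ≤ _ := pow_le_pow_left₀ (by positivity) hsin _

end

end LowEnergySimulation

open LowEnergySimulation in
theorem theorem6 :
    ∃ 𝓗 : ℝ → (n : ℕ) → Set (Matrix (Fin n) (Fin n) ℂ),
      (∀ D : ℝ, 0 < D → ∀ n : ℕ, ∀ H ∈ 𝓗 D n,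
        LowEnergySimulation.IsTwoSparse H ∧ H.PosSemidef ∧ ‖H‖ = D ∧
          IsLeast (spectrum ℝ H) 0) ∧
      ∀ γ : ℝ, 0 < γ → γ < 1 → ∃ c : ℝ, 0 < c ∧ ∃ R₀ : ℝ,
        ∀ D Δ ε τ : ℝ, 0 < D → 0 < Δ → Δ ≤ D → 0 < ε → R₀ ≤ Δ / ε → D ≤ (Δ / ε) ^ γ → 1 ≤ τ →
          ∃ (n : ℕ) (ρ : Matrix (Fin n) (Fin n) ℂ),
            (𝓗 D n).Nonempty ∧ LowEnergySimulation.IsState ρ ∧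
            (∀ H ∈ 𝓗 D n, LowEnergySimulation.energy H ρ ≤ Δ) ∧
            ∀ t : ℝ, D * |t| = τ → ∀ A : LowEnergySimulation.QueryAlgorithm n,
              (∀ H ∈ 𝓗 D n, A.Simulates H ρ t ε) →
                c * max τ (Real.log (Δ / ε) / Real.log (Real.log (Δ / ε))) ≤ (A.queries : ℝ) := by
  refine ⟨family, ?_, fun γ hγ hγ1 => ?_⟩
  · rintro D hD n _ ⟨N, hN, h, x, rfl⟩
    exact isTwoSparse_posSemidef_norm_spectrum _ hD hN x
  obtain ⟨L₀, hL₀⟩ := exists_path_length (sub_pos.mpr hγ1) (by linarith : 1 - γ < 1)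
  -- The 32 is the 8 of the path length times the 4 of `N ≤ 4 * A.queries`; for the `τ` term, `4 * π
  -- < 32` suffices.
  refine ⟨(1 - γ) / 32, by linarith, Real.exp L₀, ?_⟩
  intro D Δ ε τ hD hΔ hΔD hε hR hDR hτ
  have hR0 : 0 < Δ / ε := div_pos hΔ hε
  obtain ⟨N, hN, hNτ, hNL, hsin⟩ := hL₀ (Real.log (Δ / ε)) τ
    ((Real.le_log_iff_exp_le hR0).mpr hR) hτ
  have hp0 : 0 < Δ / D := div_pos hΔ hD
  refine ⟨Fintype.card (Site N), inputState (Fintype.equivFinOfCardEq rfl).symm (Δ / D),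
    ⟨_, (mem_family_card hN).mpr ⟨0, rfl⟩⟩,
    isState_inputState _ hp0.le ((div_le_one hD).mpr hΔD), ?_, ?_⟩
  · intro H hH
    obtain ⟨x, rfl⟩ := (mem_family_card hN).mp hH
    rw [energy_inputState _ _ _ hN, div_mul_cancel₀ _ hD.ne']
    linarith
  intro t ht A hA
  -- The exponent is even, so both signs of `t` give the same signal.
  have hsin2 : Real.sin (D / (2 * N) * t) ^ (2 * N) = Real.sin (τ / (2 * N)) ^ (2 * N) := by
    rw [← ht]
    rcases abs_choice t with h | h <;> rw [h]
    · rw [div_mul_eq_mul_div]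
    · rw [mul_neg, neg_div, Real.sin_neg, Even.neg_pow (even_two_mul N), div_mul_eq_mul_div]
  have hq := le_queries _ A D (Δ / D) t ε hN (by
    rw [hsin2]
    have h1 : D / (Δ / ε) ≤ Real.exp (-((1 - γ) * Real.log (Δ / ε))) := by
      rw [div_le_iff₀ hR0]
      refine hDR.trans (le_of_eq ?_)
      rw [Real.rpow_def_of_pos hR0]
      nth_rewrite 3 [← Real.exp_log hR0]
      rw [← Real.exp_add]
      congr 1
      ring
    have h2 : ε = Δ / D * (D / (Δ / ε)) := by field_simp
    calc 2 * ε = Δ / D * (2 * (D / (Δ / ε))) := by rw [h2]; field_simp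
      _ < _ := mul_lt_mul_of_pos_left (lt_of_le_of_lt (by linarith) hsin) hp0)
    fun x => hA _ ((mem_family_card hN).mpr ⟨x, rfl⟩)
  have hq' : (N : ℝ) ≤ 4 * A.queries := by exact_mod_cast hq
  rw [mul_max_of_nonneg _ _ (by linarith)]
  refine max_le ?_ (by linarith)
  have hπ := Real.pi_lt_d2
  rw [div_le_iff₀ Real.pi_pos] at hNτ
  nlinarith
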